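/- Let $f\in C^1([0,1])$ be of type C: there is $u_0\in(0,1)$ with $f(0)=f(u_0)=f(1)=0$, $f<0$ on $(0,u_0)$ and $f>0$ on $(u_0,1)$. Let $h\in C^1([0,1])$ satisfy $h(0)=0$, $h'(u)>0$ for all $u\in(0,1)$, and $h(u_0)<1+h(0)$. Put $f^+=\max\{f,0\}$, $f^-=\max\{-f,0\}$, $F^\pm=\int_0^1 f^\pm(u)\,du$, and assume $\int_0^1 f(u)\,du>0$ and $F^-<1$. A number $c\in\mathbb R$ is called an admissible speed if the problem $$(\star)\qquad y'=(c+h'(w))\,\frac{\sqrt{y(2-y)}}{1-y}-f(w)\ \text{ on } [0,1],\qquad y(0)=y(1)=0,\qquad 0<y(w)<1\ \text{ for } w\in(0,1)$$ has a solution $y\in C^1([0,1])$. Fix $\eta$ with $0<\eta<\min\{F^+,1\}-F^-$ and assume $$h(u_0)-h(0)<\frac{1-F^--\eta}{\sqrt{(F^-+\eta)(2-F^--\eta)}}\,\eta .$$ Then a positive admissible speed exists in each of the following two cases. 1) $F^+<1$ and $$h(1)-h(u_0)<\frac{1-F^+}{\sqrt{F^+(2-F^+)}}\,(F^+-F^--\eta).$$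 2) $F^+\ge 1$ and, for some $\zeta$ with $0<\zeta<1-F^--\eta$ and some $\xi_0\in(u_0,1)$ with $\int_{\xi_0}^1 f(u)\,du=1-\zeta$, $$h(\xi_0)-h(u_0)<\sqrt{1-\Big(\frac{1+\zeta-F^--\eta}{2}\Big)^2}-\sqrt{1-(1-F^--\eta)^2}$$ and $$h(1)-h(\xi_0)<\frac{1-\zeta-F^--\eta}{2}\,\frac{\zeta}{\sqrt{1-\zeta^2}} .$$ -/

import Mathlib

open Set

noncomputable section

/-- A reaction term of type C on `[0, 1]` with interior zero `u₀`: it is of class `C¹` on `[0, 1]`,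
vanishes at `0`, `u₀`, `1`, is negative on `(0, u₀)` and positive on `(u₀, 1)`. -/
structure IsTypeC (f : ℝ → ℝ) (u₀ : ℝ) : Prop where
  contDiffOn : ContDiffOn ℝ 1 f (Icc 0 1)
  mem_Ioo : u₀ ∈ Ioo (0 : ℝ) 1
  map_zero : f 0 = 0
  map_u₀ : f u₀ = 0
  map_one : f 1 = 0
  neg : ∀ u ∈ Ioo (0 : ℝ) u₀, f u < 0
  pos : ∀ u ∈ Ioo u₀ (1 : ℝ), 0 < f u

/-- The standing assumption on the convective term: `h` is of class `C¹` on `[0, 1]`, `h 0 = 0`,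
and `h' > 0` on `(0, 1)`. -/
structure IsConvectiveTerm (h : ℝ → ℝ) : Prop where
  contDiffOn : ContDiffOn ℝ 1 h (Icc 0 1)
  map_zero : h 0 = 0
  deriv_pos : ∀ u ∈ Ioo (0 : ℝ) 1, 0 < derivWithin h (Icc 0 1) u

/-- `R(y) = √(y(2 - y)) / (1 - y)`, the inverse of `Q(s) = 1 - 1 / √(1 + s²)`, which is the
primitive of `s P'(s)` for the mean curvature operator `P(s) = s / √(1 + s²)`. -/
def curvR (y : ℝ) : ℝ := √(y * (2 - y)) / (1 - y)

/-- `y` solves the first order two-point problem `(⋆)` with speed `c` and `d ≡ 1`: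
`y' = (c + h'(w)) R(y) - f(w)` on `[0, 1]` (with one-sided derivatives at the end points),
`y(0) = y(1) = 0`, and `0 < y < 1` on `(0, 1)`. -/
structure IsStarSolution (h f : ℝ → ℝ) (c : ℝ) (y : ℝ → ℝ) : Prop where
  ode : ∀ w ∈ Icc (0 : ℝ) 1,
    HasDerivWithinAt y ((c + derivWithin h (Icc 0 1) w) * curvR (y w) - f w) (Icc 0 1) w
  map_zero : y 0 = 0
  map_one : y 1 = 0
  pos : ∀ w ∈ Ioo (0 : ℝ) 1, 0 < y w
  lt_one : ∀ w ∈ Ioo (0 : ℝ) 1, y w < 1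

/-- `c` is an admissible speed for `(⋆)` with `d ≡ 1`. -/
def IsAdmissibleSpeed (h f : ℝ → ℝ) (c : ℝ) : Prop := ∃ y : ℝ → ℝ, IsStarSolution h f c y

/-- `F⁺`, the integral over `[0, 1]` of the positive part of `f`. -/
def posMass (f : ℝ → ℝ) : ℝ := ∫ u in (0 : ℝ)..1, max (f u) 0

/-- `F⁻`, the integral over `[0, 1]` of the negative part of `f`. -/
def negMass (f : ℝ → ℝ) : ℝ := ∫ u in (0 : ℝ)..1, max (-f u) 0

end

open Filter Topology MeasureTheory
open scoped NNReal


/-! The proof is a shooting argument from both ends to `u₀`. Putting `s = y(2 - y)` turns `y' = κ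
R(y) + g` into `s' = 2κ√s + 2g√(1 - s)`, which is no longer singular at `y = 1`. Forward from `w =
0` the source is `g = -f`; backward from `w = 1`, in `t = 1 - w`, it is `f`, with `κ` of opposite
sign. Both sources are nonnegative, and Peano's theorem supplies trajectories.

Where `s > 0`, `σ = √s` satisfies `σ' = κ + g√(1 - s)/σ`, whose last term is nonnegative and
nonincreasing in `s`. Hence the values of `σ` at `u₀` do not depend on the trajectory chosen and are
Lipschitz in `c` (`sqrt_le_sqrt_add_mul`). If they agree for some `c > 0`, the branches glue to a
solution (`isAdmissibleSpeed_of_match`). For large `c` the left value is at least `1` and the right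
one at most `1`, so it suffices to find one `c > 0` with left value at most the right
(`exists_pos_isAdmissibleSpeed`).

Such a `c` comes from barriers. On the left, `y ≤ m = F⁻ + η` gives `R(y) ≤ R(m)`, and integration
keeps `y` below `m` (`lt_of_barrier_lt`). On the right, `y` is at most the accumulated mass of `f`,
so integration bounds it below (`barrier_le`). If that mass reaches `1`, this bound is used only
down to `ξ₀`; from there to `u₀`, `σ` loses at most the integral of `c + h'`. The hypotheses are the
required strict inequalities at `c = 0`, so they persist for small `c > 0`. -/

/-! ### Peano existence by Lipschitz approximation. -/

/-- **Peano existence** for a scalar field that is a uniform limit of Lipschitz fields. -/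
theorem exists_solution_of_lipschitz_approx {F : ℝ → ℝ → ℝ} {Fn : ℕ → ℝ → ℝ → ℝ} {T : ℝ}
    (hT : 0 ≤ T) (M : ℝ≥0) (K : ℕ → ℝ≥0) (hF : Continuous (Function.uncurry F))
    (hFn : ∀ n, Continuous (Function.uncurry (Fn n)))
    (hLip : ∀ n, ∀ t ∈ Icc 0 T, LipschitzWith (K n) (Fn n t))
    (hFM : ∀ t ∈ Icc 0 T, ∀ x, |F t x| ≤ M)
    (hM : ∀ n, ∀ t ∈ Icc 0 T, ∀ x, |Fn n t x| ≤ M)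
    (hconv : ∀ ε > 0, ∀ᶠ n in atTop, ∀ t ∈ Icc 0 T, ∀ x, |Fn n t x - F t x| ≤ ε) :
    ∃ s : ℝ → ℝ, s 0 = 0 ∧ (∀ t ∈ Icc 0 T, |s t| ≤ M * T) ∧
      ∀ t ∈ Icc 0 T, HasDerivWithinAt s (F t (s t)) (Icc 0 T) t := by
  have h0 : (0 : ℝ) ∈ Icc 0 T := ⟨le_rfl, hT⟩
  have hsol : ∀ n, ∃ α : ℝ → ℝ, α 0 = 0 ∧
      ∀ t ∈ Icc 0 T, HasDerivWithinAt α (Fn n t (α t)) (Icc 0 T) t := by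
    intro n
    -- The bound `M` is global in `x`, so a ball of radius `M * T` contains the trajectory for all
    -- of `[0, T]`.
    have hpl : IsPicardLindelof (Fn n) (⟨0, h0⟩ : Icc 0 T) 0 (M * ⟨T, hT⟩) 0 M (K n) := by
      refine ⟨fun t ht => (hLip n t ht).lipschitzOnWith, fun x _ => ?_,
        fun t ht x _ => hM n t ht x, ?_⟩
      · exact ((hFn n).comp (Continuous.prodMk_left x)).continuousOn
      · simp only [sub_zero, sub_self, NNReal.coe_zero]
        rw [max_eq_left hT]
        exact le_rfl
    exact hpl.exists_eq_forall_mem_Icc_hasDerivWithinAt₀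
  choose α hα0 hα using hsol
  have hαc : ∀ n, ContinuousOn (α n) (Icc 0 T) := fun n t ht => (hα n t ht).continuousWithinAt
  have hαL : ∀ n, LipschitzOnWith M (α n) (Icc 0 T) := fun n =>
    (convex_Icc 0 T).lipschitzOnWith_of_nnnorm_hasDerivWithin_le (hα n)
      (fun t ht => by
        rw [← NNReal.coe_le_coe, coe_nnnorm]
        exact hM n t ht _)
  have hαI : ∀ n, ∀ t ∈ Icc 0 T, α n t = ∫ τ in (0 : ℝ)..t, Fn n τ (α n τ) := by
    intro n t ht
    have hsub : Icc 0 t ⊆ Icc 0 T := Icc_subset_Icc_right ht.2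
    rw [intervalIntegral.integral_eq_sub_of_hasDerivAt_of_le ht.1 ((hαc n).mono hsub)
      (fun x hx => (hα n x (hsub (Ioo_subset_Icc_self hx))).hasDerivAt
        (Icc_mem_nhds hx.1 (hx.2.trans_le ht.2))), hα0, sub_zero]
    apply ContinuousOn.intervalIntegrable
    rw [uIcc_of_le ht.1]
    exact (hFn n).comp_continuousOn (continuousOn_id.prodMk ((hαc n).mono hsub))
  let β : ℕ → BoundedContinuousFunction (Icc (0 : ℝ) T) ℝ := fun n =>
    BoundedContinuousFunction.mkOfCompact ⟨(Icc 0 T).domRestrict (α n), (hαc n).domRestrict⟩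
  have hcomp : IsCompact (closure (range β)) := by
    refine BoundedContinuousFunction.arzela_ascoli (Icc (-(M * T)) (M * T)) isCompact_Icc _ ?_ ?_
    · rintro _ x ⟨n, rfl⟩
      have h := (hαL n).dist_le_mul x x.2 0 h0
      rw [hα0, Real.dist_eq, Real.dist_eq, sub_zero, sub_zero, abs_of_nonneg x.2.1] at h
      exact abs_le.1 (h.trans (mul_le_mul_of_nonneg_left x.2.2 M.2))
    · refine (LipschitzWith.uniformEquicontinuous _ M ?_).equicontinuous
      rintro ⟨_, n, rfl⟩
      exact (lipschitzOnWith_iff_restrict.1 (hαL n))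
  obtain ⟨b, -, φ, hφ, hlim⟩ := hcomp.tendsto_subseq (fun n => subset_closure (mem_range_self n))
  set S : ℝ → ℝ := IccExtend hT b with hS
  have hSc : Continuous S := b.continuous.Icc_extend'
  have hptw : ∀ t ∈ Icc 0 T, Tendsto (fun n => α (φ n) t) atTop (𝓝 (S t)) := by
    intro t ht
    have := ((continuous_eval_const (F := BoundedContinuousFunction (Icc (0 : ℝ) T) ℝ)
      ⟨t, ht⟩).tendsto b).comp
      hlim
    rw [hS, IccExtend_of_mem _ _ ht]
    exact this
  have hFS : Continuous fun τ => F τ (S τ) := hF.comp (continuous_id.prodMk hSc)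
  have hSI : ∀ t ∈ Icc 0 T, S t = ∫ τ in (0 : ℝ)..t, F τ (S τ) := by
    intro t ht
    have hsub : Icc 0 t ⊆ Icc 0 T := Icc_subset_Icc_right ht.2
    refine tendsto_nhds_unique (hptw t ht) ?_
    simp_rw [fun n => hαI (φ n) t ht]
    refine intervalIntegral.tendsto_integral_filter_of_dominated_convergence (fun _ => (M : ℝ))
      ?_ ?_ intervalIntegrable_const ?_
    · refine Eventually.of_forall fun n => ?_
      refine ContinuousOn.aestronglyMeasurable ?_ measurableSet_uIoc
      rw [uIoc_of_le ht.1]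
      exact (hFn _).comp_continuousOn (continuousOn_id.prodMk
        ((hαc _).mono (Ioc_subset_Icc_self.trans hsub)))
    · refine Eventually.of_forall fun n => Eventually.of_forall fun τ hτ => ?_
      rw [uIoc_of_le ht.1] at hτ
      exact hM _ _ (hsub (Ioc_subset_Icc_self hτ)) _
    · refine Eventually.of_forall fun τ hτ => ?_
      rw [uIoc_of_le ht.1] at hτ
      have hτ' := hsub (Ioc_subset_Icc_self hτ)
      have h1 : Tendsto (fun n => F τ (α (φ n) τ)) atTop (𝓝 (F τ (S τ))) :=
        ((hF.comp (Continuous.prodMk_right τ)).tendsto _).comp (hptw τ hτ')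
      have h2 : Tendsto (fun n => Fn (φ n) τ (α (φ n) τ) - F τ (α (φ n) τ)) atTop (𝓝 0) := by
        rw [Metric.tendsto_nhds]
        intro ε hε
        filter_upwards [hφ.tendsto_atTop.eventually (hconv (ε / 2) (half_pos hε))] with n hn
        rw [Real.dist_eq, sub_zero]
        exact (hn τ hτ' _).trans_lt (half_lt_self hε)
      simpa using h2.add h1
  -- The integral, rather than the limit `S`, is the witness: it is differentiable at the end points
  -- too, and equals `S` on `[0, T]`.
  refine ⟨fun t => ∫ τ in (0 : ℝ)..t, F τ (S τ), by simp, fun t ht => ?_, fun t ht => ?_⟩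
  · have h := intervalIntegral.norm_integral_le_of_norm_le_const (a := 0) (b := t) (C := M)
      (f := fun τ => F τ (S τ)) (fun τ hτ => by
        rw [uIoc_of_le ht.1] at hτ
        exact hFM τ ⟨hτ.1.le, hτ.2.trans ht.2⟩ _)
    rw [sub_zero, abs_of_nonneg ht.1] at h
    exact h.trans (mul_le_mul_of_nonneg_left ht.2 M.2)
  · simp only [← hSI t ht]
    exact (hFS.integral_hasStrictDerivAt 0 t).hasDerivAt.hasDerivWithinAt

/-! ### The desingularised equation and its solvability. -/

/-- The square root of the truncation of `x` to `[0, K]`, shifted by `ε`. -/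
noncomputable def truncSqrt (K ε x : ℝ) : ℝ := √(max 0 (min x K) + ε)

theorem continuous_truncSqrt (K ε : ℝ) : Continuous (truncSqrt K ε) := by
  unfold truncSqrt; fun_prop

theorem truncSqrt_nonneg (K ε x : ℝ) : 0 ≤ truncSqrt K ε x := Real.sqrt_nonneg _

theorem truncSqrt_le {K ε x : ℝ} (hK : 0 ≤ K) (hε : ε ≤ 1) : truncSqrt K ε x ≤ √(K + 1) :=
  Real.sqrt_le_sqrt (add_le_add (max_le hK (min_le_right _ _)) hε)

theorem truncSqrt_zero_of_le {K x : ℝ} (hx : x ≤ K) : truncSqrt K 0 x = √x := by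
  rw [truncSqrt, min_eq_left hx, add_zero]
  rcases le_total 0 x with h | h
  · rw [max_eq_right h]
  · rw [max_eq_left h, Real.sqrt_zero, Real.sqrt_eq_zero_of_nonpos h]

theorem abs_truncSqrt_sub_le {K ε x : ℝ} (hε : 0 ≤ ε) :
    |truncSqrt K ε x - truncSqrt K 0 x| ≤ √ε := by
  unfold truncSqrt
  set a := max 0 (min x K)
  have ha : 0 ≤ a := le_max_left _ _
  rw [add_zero, abs_of_nonneg (sub_nonneg.2 (Real.sqrt_le_sqrt (by linarith)))]
  rw [sub_le_iff_le_add', Real.sqrt_le_left (by positivity)]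
  nlinarith [Real.sq_sqrt ha, Real.sq_sqrt hε, mul_nonneg (Real.sqrt_nonneg a) (Real.sqrt_nonneg ε)]

theorem lipschitzWith_truncSqrt (K : ℝ) {ε : ℝ} (hε : 0 < ε) :
    LipschitzWith (Real.toNNReal (1 / √ε)) (truncSqrt K ε) := by
  refine LipschitzWith.of_dist_le_mul fun x y => ?_
  have hε' := Real.sqrt_pos.2 hε
  rw [Real.coe_toNNReal _ (by positivity), Real.dist_eq, Real.dist_eq]
  have h1 : |max 0 (min x K) - max 0 (min y K)| ≤ |x - y| :=
    (abs_max_sub_max_le_max _ _ _ _).trans (by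
      simp only [sub_self, abs_zero]
      exact max_le (abs_nonneg _) ((abs_min_sub_min_le_max _ _ _ _).trans (by simp)))
  unfold truncSqrt
  set a := max 0 (min x K)
  set b := max 0 (min y K)
  have ha : 0 ≤ a := le_max_left _ _
  have hb : 0 ≤ b := le_max_left _ _
  have h2 : (√(a + ε) - √(b + ε)) * (√(a + ε) + √(b + ε)) = a - b := by
    have e1 := Real.sq_sqrt (show 0 ≤ a + ε by linarith)
    have e2 := Real.sq_sqrt (show 0 ≤ b + ε by linarith)
    linear_combination e1 - e2
  have h3 : √ε ≤ √(a + ε) + √(b + ε) := by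
    have := Real.sqrt_le_sqrt (show ε ≤ a + ε by linarith)
    linarith [Real.sqrt_nonneg (b + ε)]
  rw [one_div, inv_mul_eq_div, le_div_iff₀ hε']
  refine le_trans ?_ h1
  rw [← h2, abs_mul, abs_of_nonneg (hε'.le.trans h3)]
  exact mul_le_mul_of_nonneg_left h3 (abs_nonneg _)

/-- `s = y (2 - y)`, for a solution `y` of `y' = κ R(y) + g` issuing from `0`. -/
structure IsSquareSolution (κ g : ℝ → ℝ) (T : ℝ) (s : ℝ → ℝ) : Prop where
  map_zero : s 0 = 0
  hasDeriv : ∀ t ∈ Icc 0 T,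
    HasDerivWithinAt s (2 * κ t * √(s t) + 2 * g t * √(1 - s t)) (Icc 0 T) t

theorem exists_isSquareSolution {κ g : ℝ → ℝ} {T : ℝ} (hT : 0 ≤ T)
    (hκ : ContinuousOn κ (Icc 0 T)) (hg : ContinuousOn g (Icc 0 T)) :
    ∃ s, IsSquareSolution κ g T s := by
  obtain ⟨A₁, hA₁⟩ := isCompact_Icc.exists_bound_of_continuousOn hκ
  obtain ⟨A₂, hA₂⟩ := isCompact_Icc.exists_bound_of_continuousOn hg
  set A := max A₁ A₂
  set κ' := IccExtend hT ((Icc 0 T).domRestrict κ) with hκ'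
  set g' := IccExtend hT ((Icc 0 T).domRestrict g) with hg'
  have hκc : Continuous κ' := hκ.domRestrict.Icc_extend'
  have hgc : Continuous g' := hg.domRestrict.Icc_extend'
  have eκ : ∀ t ∈ Icc 0 T, κ' t = κ t := fun t ht => IccExtend_of_mem hT _ ht
  have eg : ∀ t ∈ Icc 0 T, g' t = g t := fun t ht => IccExtend_of_mem hT _ ht
  have bκ : ∀ t ∈ Icc 0 T, |κ' t| ≤ A := fun t ht => by
    rw [eκ t ht]; exact (hA₁ t ht).trans (le_max_left _ _)
  have bg : ∀ t ∈ Icc 0 T, |g' t| ≤ A := fun t ht => by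
    rw [eg t ht]; exact (hA₂ t ht).trans (le_max_right _ _)
  have hA : 0 ≤ A := (abs_nonneg _).trans (bκ 0 ⟨le_rfl, hT⟩)
  -- The truncated field is bounded by `4A√(K + 1) = 4Ab`, so `|s| ≤ 4AbT = b(b - 2) ≤ K - 1`. Hence
  -- `s` and `1 - s` stay below `K` and the truncation is never active.
  set b := 4 * A * T + 2
  have hb : 2 ≤ b := by have : 0 ≤ 4 * A * T := by positivity
                        linarith
  set K := b ^ 2 - 1
  have hK : 0 ≤ K := by nlinarith
  have hKb : √(K + 1) = b := by
    rw [show K + 1 = b ^ 2 by ring]; exact Real.sqrt_sq (by linarith)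
  let Φ : ℝ → ℝ → ℝ → ℝ := fun ε t x =>
    2 * κ' t * truncSqrt K ε x + 2 * g' t * truncSqrt K ε (1 - x)
  have hΦc : ∀ ε, Continuous (Function.uncurry (Φ ε)) := fun ε => by
    have := continuous_truncSqrt K ε
    simp only [Φ, Function.uncurry_def]
    fun_prop
  have hΦM : ∀ ε ≤ 1, ∀ t ∈ Icc 0 T, ∀ x, |Φ ε t x| ≤ 4 * A * b := by
    intro ε hε t ht x
    have key : ∀ p z : ℝ, |p| ≤ A → |2 * p * truncSqrt K ε z| ≤ 2 * A * b := by
      intro p z hp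
      rw [abs_mul, abs_mul, abs_two, abs_of_nonneg (truncSqrt_nonneg _ _ _)]
      have := truncSqrt_le (x := z) hK hε
      rw [hKb] at this
      exact mul_le_mul (by linarith) this (truncSqrt_nonneg _ _ _) (by positivity)
    calc |Φ ε t x| ≤ _ := abs_add_le _ _
      _ ≤ 2 * A * b + 2 * A * b := add_le_add (key _ _ (bκ t ht)) (key _ _ (bg t ht))
      _ = 4 * A * b := by ring
  have hn : ∀ n : ℕ, (1 : ℝ) / (n + 1) ≤ 1 := fun n => by
    rw [div_le_one (by positivity)]; linarith [n.cast_nonneg (α := ℝ)]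
  have hn0 : ∀ n : ℕ, (0 : ℝ) < 1 / (n + 1) := fun n => by positivity
  obtain ⟨s, h0, hbd, hd⟩ := exists_solution_of_lipschitz_approx (F := Φ 0)
    (Fn := fun n => Φ (1 / (n + 1))) hT ⟨4 * A * b, by positivity⟩
    (fun n => Real.toNNReal (4 * A * (1 / √(1 / (n + 1))))) (hΦc 0) (fun n => hΦc _)
    (fun n t ht => by
      refine LipschitzWith.of_dist_le_mul fun x y => ?_
      set L := 1 / √((1 : ℝ) / (n + 1))
      have hL : 0 ≤ L := by positivity
      rw [Real.coe_toNNReal _ (by positivity), Real.dist_eq, Real.dist_eq]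
      have l1 : ∀ x y, |truncSqrt K (1 / (n + 1)) x - truncSqrt K (1 / (n + 1)) y| ≤ L * |x - y| := by
        intro x y
        have := (lipschitzWith_truncSqrt K (hn0 n)).dist_le_mul x y
        rwa [Real.coe_toNNReal _ hL, Real.dist_eq, Real.dist_eq] at this
      have l2 := l1 (1 - x) (1 - y)
      rw [show (1 - x) - (1 - y) = -(x - y) by ring, abs_neg] at l2
      have key : ∀ p z : ℝ, |p| ≤ A → |z| ≤ L * |x - y| → |2 * p * z| ≤ 2 * A * (L * |x - y|) := by
        intro p z hp hz
        rw [abs_mul, abs_mul, abs_two]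
        exact mul_le_mul (by linarith) hz (abs_nonneg _) (by positivity)
      have e : Φ (1 / (n + 1)) t x - Φ (1 / (n + 1)) t y =
          2 * κ' t * (truncSqrt K (1 / (n + 1)) x - truncSqrt K (1 / (n + 1)) y) +
          2 * g' t * (truncSqrt K (1 / (n + 1)) (1 - x) - truncSqrt K (1 / (n + 1)) (1 - y)) := by
        simp only [Φ]; ring
      rw [e]
      refine (abs_add_le _ _).trans ?_
      linarith [key _ _ (bκ t ht) (l1 x y), key _ _ (bg t ht) l2])
    (fun t ht x => hΦM 0 zero_le_one t ht x) (fun n t ht x => hΦM _ (hn n) t ht x)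
    (fun ε hε => by
      have hlim : Tendsto (fun n : ℕ => 4 * A * √((1 : ℝ) / (n + 1))) atTop (𝓝 0) := by
        have := (Real.continuous_sqrt.tendsto 0).comp
          (tendsto_one_div_add_atTop_nhds_zero_nat (𝕜 := ℝ))
        simpa using this.const_mul (4 * A)
      filter_upwards [hlim.eventually_le_const hε] with n hnε t ht x
      have key : ∀ p z : ℝ, |p| ≤ A →
          |2 * p * (truncSqrt K (1 / (n + 1)) z - truncSqrt K 0 z)| ≤
            2 * A * √((1 : ℝ) / (n + 1)) := by
        intro p z hp
        rw [abs_mul, abs_mul, abs_two]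
        exact mul_le_mul (by linarith) (abs_truncSqrt_sub_le (hn0 n).le) (abs_nonneg _)
          (by positivity)
      have e : Φ (1 / (n + 1)) t x - Φ 0 t x =
          2 * κ' t * (truncSqrt K (1 / (n + 1)) x - truncSqrt K 0 x) +
          2 * g' t * (truncSqrt K (1 / (n + 1)) (1 - x) - truncSqrt K 0 (1 - x)) := by
        simp only [Φ]; ring
      rw [e]
      refine (abs_add_le _ _).trans ?_
      linarith [key _ x (bκ t ht), key _ (1 - x) (bg t ht)])
  refine ⟨s, h0, fun t ht => ?_⟩
  have h1 : |s t| ≤ K - 1 := by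
    refine (hbd t ht).trans ?_
    change 4 * A * b * T ≤ K - 1
    have : 4 * A * b * T = (b - 2) * b := by ring
    nlinarith
  have h2 := abs_le.1 h1
  have h3 := hd t ht
  simp only [Φ, eκ t ht, eg t ht] at h3
  rwa [truncSqrt_zero_of_le (by linarith), truncSqrt_zero_of_le (by linarith)] at h3

/-! ### Sign and comparison principles. -/

theorem HasDerivWithinAt.nonpos_of_le_left {s : ℝ → ℝ} {d T t : ℝ}
    (hd : HasDerivWithinAt s d (Icc 0 T) t) (ht : t ∈ Ioc 0 T)
    (hmin : ∀ x ∈ Icc 0 t, s t ≤ s x) : d ≤ 0 := by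
  have hd' := hd.mono (Icc_subset_Icc_right ht.2)
  have hloc : IsLocalMinOn s (Icc 0 t) t := IsMinOn.localize fun x hx => hmin x hx
  have hcone : (0 : ℝ) - t ∈ posTangentConeAt (Icc 0 t) t :=
    sub_mem_posTangentConeAt_of_segment_subset (by rw [segment_symm, segment_eq_Icc ht.1.le])
  have h : 0 ≤ (0 - t) * d := by
    simpa using! hloc.hasFDerivWithinAt_nonneg hd'.hasFDerivWithinAt hcone
  nlinarith [ht.1]

/-- A nonpositive minimum over `[0, t]` attained away from `0` would have derivative at most `0`,
against `hpos`. -/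
theorem pos_of_deriv_pos_of_nonpos {s s' : ℝ → ℝ} {T t : ℝ} (h0 : 0 ≤ s 0)
    (hd : ∀ x ∈ Icc 0 T, HasDerivWithinAt s (s' x) (Icc 0 T) x) (ht : t ∈ Ioc 0 T)
    (hpos : ∀ x ∈ Ioc 0 t, s x ≤ 0 → 0 < s' x) : 0 < s t := by
  by_contra! hst
  have hsub : Icc 0 t ⊆ Icc 0 T := Icc_subset_Icc_right ht.2
  obtain ⟨z, hz, hzmin⟩ := isCompact_Icc.exists_isMinOn (nonempty_Icc.2 ht.1.le)
    (fun x hx => ((hd x (hsub hx)).mono hsub).continuousWithinAt)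
  have htz : s z ≤ s t := hzmin ⟨ht.1.le, le_rfl⟩
  have key : ∀ w ∈ Ioc 0 t, s w ≤ s z → False := by
    intro w hw hwz
    have := (hd w ⟨hw.1.le, hw.2.trans ht.2⟩).nonpos_of_le_left ⟨hw.1, hw.2.trans ht.2⟩
      (fun x hx => hwz.trans (hzmin ⟨hx.1, hx.2.trans hw.2⟩))
    exact absurd (hpos w hw (by linarith)) (not_lt.2 this)
  rcases hz.1.eq_or_lt with h | h
  -- If the minimiser is `0`, then `s t ≤ 0 ≤ s 0`, so `t` is a minimiser as well.
  · exact key t ⟨ht.1, le_rfl⟩ (by rw [← h]; linarith)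
  · exact key z ⟨h, hz.2⟩ le_rfl

theorem le_of_forall_hasDerivAt_nonneg {f : ℝ → ℝ} {a b : ℝ} (hab : a ≤ b)
    (hf : ContinuousOn f (Icc a b)) (hd : ∀ x ∈ Ioo a b, ∃ d, 0 ≤ d ∧ HasDerivAt f d x) :
    f a ≤ f b := by
  refine monotoneOn_of_deriv_nonneg (convex_Icc a b) hf ?_ ?_ (left_mem_Icc.2 hab)
    (right_mem_Icc.2 hab) hab
  · intro x hx
    rw [interior_Icc] at hx
    obtain ⟨d, -, h⟩ := hd x hx
    exact h.differentiableAt.differentiableWithinAt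
  · intro x hx
    rw [interior_Icc] at hx
    obtain ⟨d, h0, h⟩ := hd x hx
    rwa [h.deriv]

/-- A function starting at a nonpositive value stays nonpositive if it is nonincreasing wherever
it takes small positive values. -/
theorem nonpos_of_deriv_nonpos_of_small_pos {D : ℝ → ℝ} {a b δ : ℝ} (hδ : 0 < δ)
    (hD : ContinuousOn D (Icc a b)) (ha : D a ≤ 0)
    (hd : ∀ t ∈ Ioo a b, 0 < D t → D t < δ → ∃ d, d ≤ 0 ∧ HasDerivAt D d t) :
    ∀ t ∈ Icc a b, D t ≤ 0 := by
  intro t₁ ht₁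
  by_contra! hpos
  have hD₁ : ContinuousOn D (Icc a t₁) := hD.mono (Icc_subset_Icc_right ht₁.2)
  -- `τ` is the last point of `[a, t₁]` with `D ≤ 0`. Just after it `D` is positive and small, hence
  -- nonincreasing, so it cannot have risen above `D τ`.
  obtain ⟨τ, ⟨hτ, hτ0⟩, hgr⟩ := (isCompact_Icc.of_isClosed_subset
    (hD₁.preimage_isClosed_of_isClosed isClosed_Icc isClosed_Iic) inter_subset_left).exists_isGreatest
    ⟨a, ⟨le_rfl, ht₁.1⟩, ha⟩
  have hτ0 : D τ ≤ 0 := hτ0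
  have hτt : τ < t₁ := lt_of_le_of_ne hτ.2 (by rintro rfl; linarith)
  have hgt : ∀ x ∈ Ioc τ t₁, 0 < D x := by
    intro x hx
    by_contra! h
    exact absurd (hgr ⟨⟨hτ.1.trans hx.1.le, hx.2⟩, h⟩) (not_le.2 hx.1)
  have hev : ∀ᶠ x in 𝓝[>] τ, D x < δ := by
    have hc : Tendsto D (𝓝[>] τ) (𝓝 (D τ)) :=
      (hD₁ τ hτ).mono_left (nhdsWithin_le_of_mem
        (mem_of_superset (Ioc_mem_nhdsGT hτt) fun x hx => ⟨hτ.1.trans hx.1.le, hx.2⟩))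
    exact hc.eventually_lt_const (by linarith)
  obtain ⟨t₂, ht₂, hlt⟩ := (mem_nhdsGT_iff_exists_Ioc_subset).1 hev
  set t₃ := min t₁ t₂
  have hτ3 : τ < t₃ := lt_min hτt ht₂
  have h3 : -D τ ≤ -D t₃ := by
    refine le_of_forall_hasDerivAt_nonneg (f := fun x => -D x) hτ3.le
      (hD₁.mono (Icc_subset_Icc hτ.1 (min_le_left _ _))).neg ?_
    intro x hx
    obtain ⟨d, hd0, hdx⟩ := hd x ⟨hτ.1.trans_lt hx.1, hx.2.trans_le ((min_le_left _ _).trans ht₁.2)⟩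
      (hgt x ⟨hx.1, hx.2.le.trans (min_le_left _ _)⟩)
      (hlt ⟨hx.1, hx.2.le.trans (min_le_right _ _)⟩)
    exact ⟨-d, by linarith, hdx.neg⟩
  linarith [hgt t₃ ⟨hτ3, min_le_left _ _⟩]

theorem curvR_le_curvR {y m : ℝ} (hym : y ≤ m) (hm : m < 1) : curvR y ≤ curvR m := by
  unfold curvR
  refine div_le_div₀ (Real.sqrt_nonneg _) (Real.sqrt_le_sqrt ?_) (by linarith) (by linarith)
  nlinarith

theorem curvR_one_sub_sqrt {s : ℝ} (hs : s ≤ 1) : curvR (1 - √(1 - s)) = √s / √(1 - s) := by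
  have h := Real.sq_sqrt (sub_nonneg.2 hs)
  unfold curvR
  congr 2
  · linear_combination -h
  · ring

theorem curvR_one_sub_sqrt_nonneg {s : ℝ} (hs : s ≤ 1) : 0 ≤ curvR (1 - √(1 - s)) := by
  rw [curvR_one_sub_sqrt hs]; positivity

/-! ### A priori estimates for trajectories. -/

namespace IsSquareSolution

variable {κ g s H Γ : ℝ → ℝ} {T : ℝ}

theorem continuousOn (hs : IsSquareSolution κ g T s) : ContinuousOn s (Icc 0 T) :=
  fun t ht => (hs.hasDeriv t ht).continuousWithinAt

/-- Where `s ≤ 0` the field reduces to `2g√(1 - s) > 0`. The end point `T` is left out because `g`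
may vanish there. -/
theorem pos (hs : IsSquareSolution κ g T s) (hg : ∀ t ∈ Ioo 0 T, 0 < g t) {t : ℝ}
    (ht : t ∈ Ioo 0 T) : 0 < s t := by
  refine pos_of_deriv_pos_of_nonpos hs.map_zero.ge hs.hasDeriv (Ioo_subset_Ioc_self ht)
    fun x hx hsx => ?_
  rw [Real.sqrt_eq_zero_of_nonpos hsx, mul_zero, zero_add]
  have := Real.sqrt_pos.2 (show 0 < 1 - s x by linarith)
  have := hg x ⟨hx.1, hx.2.trans_lt ht.2⟩
  positivity

/-- Where `s ≥ 1` the field reduces to `2κ√s < 0`. -/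
theorem lt_one (hs : IsSquareSolution κ g T s) (hκ : ∀ t ∈ Ioc 0 T, κ t < 0) {t : ℝ}
    (ht : t ∈ Icc 0 T) : s t < 1 := by
  rcases ht.1.eq_or_lt with rfl | h
  · rw [hs.map_zero]; exact one_pos
  rw [← sub_pos]
  refine pos_of_deriv_pos_of_nonpos (s := fun x => 1 - s x) (by simp [hs.map_zero])
    (fun x hx => (hs.hasDeriv x hx).const_sub 1) ⟨h, ht.2⟩ fun x hx hsx => ?_
  rw [Real.sqrt_eq_zero_of_nonpos hsx, mul_zero, add_zero]
  have h1 := Real.sqrt_pos.2 (show 0 < s x by linarith)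
  have h2 := hκ x ⟨hx.1, hx.2.trans ht.2⟩
  nlinarith

theorem hasDerivAt_sqrt (hs : IsSquareSolution κ g T s) {t : ℝ} (ht : t ∈ Ioo 0 T)
    (hpos : 0 < s t) :
    HasDerivAt (fun x => √(s x)) (κ t + g t * (√(1 - s t) / √(s t))) t := by
  have h := ((hs.hasDeriv t (Ioo_subset_Icc_self ht)).hasDerivAt
    (Icc_mem_nhds ht.1 ht.2)).sqrt hpos.ne'
  have := (Real.sqrt_pos.2 hpos).ne'
  convert h using 1
  field_simp

theorem hasDerivWithinAt_one_sub_sqrt (hs : IsSquareSolution κ g T s) {t : ℝ} (ht : t ∈ Icc 0 T)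
    (hlt : s t < 1) :
    HasDerivWithinAt (fun x => 1 - √(1 - s x)) (κ t * curvR (1 - √(1 - s t)) + g t)
      (Icc 0 T) t := by
  have h1 : 0 < 1 - s t := by linarith
  have h := (((hs.hasDeriv t ht).const_sub 1).sqrt h1.ne').const_sub 1
  have := (Real.sqrt_pos.2 h1).ne'
  rw [curvR_one_sub_sqrt hlt.le]
  refine h.congr_deriv ?_
  field_simp

/-- Once `√s₁` exceeds `√s₂ + Ct`, the source term for `s₁` is at most that for `s₂`, so the excess
cannot grow. With `κ₁ = κ₂` and `C = 0` this is uniqueness of `√s`. -/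
theorem sqrt_le_sqrt_add_mul {κ₁ κ₂ s₁ s₂ : ℝ → ℝ} {C : ℝ} (hC : 0 ≤ C)
    (hg : ∀ t ∈ Ioo 0 T, 0 < g t) (h₁ : IsSquareSolution κ₁ g T s₁)
    (h₂ : IsSquareSolution κ₂ g T s₂) (hκ : ∀ t ∈ Ioo 0 T, κ₁ t ≤ κ₂ t + C) {t : ℝ}
    (ht : t ∈ Icc 0 T) : √(s₁ t) ≤ √(s₂ t) + C * t := by
  suffices h : √(s₁ t) - √(s₂ t) - C * t ≤ 0 by linarith
  refine nonpos_of_deriv_nonpos_of_small_pos (D := fun t => √(s₁ t) - √(s₂ t) - C * t) one_pos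
    ?_ ?_ ?_ t ht
  · exact (h₁.continuousOn.sqrt.sub h₂.continuousOn.sqrt).sub (by fun_prop)
  · simp [h₁.map_zero, h₂.map_zero]
  · intro x hx hpos _
    have p₁ := h₁.pos hg hx
    have p₂ := h₂.pos hg hx
    refine ⟨_, ?_, ((h₁.hasDerivAt_sqrt hx p₁).sub (h₂.hasDerivAt_sqrt hx p₂)).sub
      ((hasDerivAt_id x).const_mul C)⟩
    have hlt : √(s₂ x) < √(s₁ x) := by
      have : 0 ≤ C * x := mul_nonneg hC hx.1.le
      linarith
    have hle : s₂ x ≤ s₁ x := (Real.sqrt_lt_sqrt_iff p₂.le).1 hlt |>.le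
    have hq : √(1 - s₁ x) / √(s₁ x) ≤ √(1 - s₂ x) / √(s₂ x) :=
      div_le_div₀ (Real.sqrt_nonneg _) (Real.sqrt_le_sqrt (by linarith)) (Real.sqrt_pos.2 p₂) hlt.le
    have := mul_le_mul_of_nonneg_left hq (hg x hx).le
    linarith [hκ x hx]

theorem sub_le_sqrt_sub_sqrt (hs : IsSquareSolution κ g T s) (hg : ∀ t ∈ Ioo 0 T, 0 < g t)
    (hH : ∀ t ∈ Icc 0 T, HasDerivWithinAt H (κ t) (Icc 0 T) t) {a b : ℝ} (ha : 0 ≤ a)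
    (hab : a ≤ b) (hb : b ≤ T) : H b - H a ≤ √(s b) - √(s a) := by
  have hsub : Icc a b ⊆ Icc 0 T := Icc_subset_Icc ha hb
  suffices h : √(s a) - H a ≤ √(s b) - H b by linarith
  refine le_of_forall_hasDerivAt_nonneg (f := fun x => √(s x) - H x) hab
    ((hs.continuousOn.sqrt.sub fun t ht => (hH t ht).continuousWithinAt).mono hsub) ?_
  intro x hx
  have hx' : x ∈ Ioo 0 T := ⟨ha.trans_lt hx.1, hx.2.trans_le hb⟩
  refine ⟨_, ?_, (hs.hasDerivAt_sqrt hx' (hs.pos hg hx')).sub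
    ((hH x (Ioo_subset_Icc_self hx')).hasDerivAt (Icc_mem_nhds hx'.1 hx'.2))⟩
  have := hg x hx'
  have : 0 ≤ g x * (√(1 - s x) / √(s x)) := by positivity
  linarith

/-- While `y < m`, one has `y' ≤ κ R(m) + g = B'`; as `B` stays below `m`, so does `y`. -/
theorem lt_of_barrier_lt (hs : IsSquareSolution κ g T s) (hκ : ∀ t ∈ Icc 0 T, 0 ≤ κ t)
    (hg : ∀ t ∈ Icc 0 T, 0 ≤ g t)
    (hH : ∀ t ∈ Icc 0 T, HasDerivWithinAt H (κ t) (Icc 0 T) t)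
    (hΓ : ∀ t ∈ Icc 0 T, HasDerivWithinAt Γ (g t) (Icc 0 T) t) (hH0 : H 0 = 0) (hΓ0 : Γ 0 = 0)
    (hT : 0 ≤ T) {m : ℝ} (hm : m < 1) (hB : Γ T + curvR m * H T < m) :
    s T < m * (2 - m) := by
  have hR : 0 ≤ curvR m := div_nonneg (Real.sqrt_nonneg _) (by linarith)
  set B : ℝ → ℝ := fun t => Γ t + curvR m * H t with hBdef
  have hBd : ∀ t ∈ Icc 0 T, HasDerivWithinAt B (g t + curvR m * κ t) (Icc 0 T) t :=
    fun t ht => (hΓ t ht).add ((hH t ht).const_mul _)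
  have hBc : ContinuousOn B (Icc 0 T) := fun t ht => (hBd t ht).continuousWithinAt
  have hBmono : ∀ t ∈ Icc 0 T, B t ≤ B T := fun t ht =>
    le_of_forall_hasDerivAt_nonneg ht.2 (hBc.mono (Icc_subset_Icc_left ht.1)) fun x hx =>
      have hx' : x ∈ Ioo 0 T := ⟨ht.1.trans_lt hx.1, hx.2⟩
      have hx'' := Ioo_subset_Icc_self hx'
      ⟨_, add_nonneg (hg x hx'') (mul_nonneg hR (hκ x hx'')),
        (hBd x hx'').hasDerivAt (Icc_mem_nhds hx'.1 hx'.2)⟩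
  have hBT : B T < m := hB
  -- With `δ = m - B T`, an excess of `y` over `B t` smaller than `δ` forces `y < m`, and hence also
  -- `s < 1`, which is not known beforehand when `κ ≥ 0`.
  have hle := nonpos_of_deriv_nonpos_of_small_pos (D := fun t => 1 - √(1 - s t) - B t)
    (sub_pos.2 hBT) (a := 0) (b := T)
    ((continuousOn_const.sub (continuousOn_const.sub hs.continuousOn).sqrt).sub hBc)
    (by simp [hs.map_zero, hBdef, hH0, hΓ0]) (by
      intro t ht _ hlt
      have ht' := Ioo_subset_Icc_self ht
      have hy : 1 - √(1 - s t) < m := by linarith [hBmono t ht']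
      have hst : s t < 1 := by
        have := Real.sqrt_pos.1 (show 0 < √(1 - s t) by linarith)
        linarith
      refine ⟨_, ?_, ((hs.hasDerivWithinAt_one_sub_sqrt ht' hst).sub (hBd t ht')).hasDerivAt
        (Icc_mem_nhds ht.1 ht.2)⟩
      have := mul_le_mul_of_nonneg_left (curvR_le_curvR hy.le hm) (hκ t ht')
      linarith) T ⟨hT, le_rfl⟩
  have h1 : 1 - m < √(1 - s T) := by linarith
  have h2 := (Real.lt_sqrt (by linarith)).1 h1
  linarith

/-- Since `κ < 0`, `y ≤ Γ ≤ Γ b` on `[0, b]`, so `κ R(y) ≥ κ R(Γ b)`; this integrates to the bound.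
-/
theorem barrier_le (hs : IsSquareSolution κ g T s) (hκ : ∀ t ∈ Icc 0 T, κ t < 0)
    (hg : ∀ t ∈ Icc 0 T, 0 ≤ g t)
    (hH : ∀ t ∈ Icc 0 T, HasDerivWithinAt H (κ t) (Icc 0 T) t)
    (hΓ : ∀ t ∈ Icc 0 T, HasDerivWithinAt Γ (g t) (Icc 0 T) t) (hH0 : H 0 = 0) (hΓ0 : Γ 0 = 0)
    {b : ℝ} (hb : b ∈ Icc 0 T) (hm : Γ b < 1) :
    Γ b + curvR (Γ b) * H b ≤ 1 - √(1 - s b) := by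
  have hlt : ∀ t ∈ Icc 0 T, s t < 1 := fun t ht =>
    hs.lt_one (fun t ht => hκ t (Ioc_subset_Icc_self ht)) ht
  have hΓc : ContinuousOn Γ (Icc 0 T) := fun t ht => (hΓ t ht).continuousWithinAt
  have hHc : ContinuousOn H (Icc 0 T) := fun t ht => (hH t ht).continuousWithinAt
  have hyc : ContinuousOn (fun t => 1 - √(1 - s t)) (Icc 0 T) :=
    continuousOn_const.sub (continuousOn_const.sub hs.continuousOn).sqrt
  have hmono : ∀ t ∈ Icc 0 b, Γ t ≤ Γ b := fun t ht =>
    le_of_forall_hasDerivAt_nonneg ht.2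
      (hΓc.mono (Icc_subset_Icc ht.1 hb.2)) fun x hx =>
      have hx' : x ∈ Ioo 0 T := ⟨ht.1.trans_lt hx.1, hx.2.trans_le hb.2⟩
      ⟨_, hg x (Ioo_subset_Icc_self hx'),
        (hΓ x (Ioo_subset_Icc_self hx')).hasDerivAt (Icc_mem_nhds hx'.1 hx'.2)⟩
  have hyΓ : ∀ t ∈ Icc 0 b, 1 - √(1 - s t) ≤ Γ t := by
    intro t ht
    have := le_of_forall_hasDerivAt_nonneg (f := fun t => Γ t - (1 - √(1 - s t))) ht.1
      ((hΓc.sub hyc).mono (Icc_subset_Icc_right (ht.2.trans hb.2))) (by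
        intro x hx
        have hx' : x ∈ Ioo 0 T := ⟨hx.1, hx.2.trans_le (ht.2.trans hb.2)⟩
        have hx'' := Ioo_subset_Icc_self hx'
        refine ⟨_, ?_, ((hΓ x hx'').sub (hs.hasDerivWithinAt_one_sub_sqrt hx''
          (hlt x hx''))).hasDerivAt (Icc_mem_nhds hx'.1 hx'.2)⟩
        have := mul_nonneg (neg_nonneg.2 (hκ x hx'').le)
          (curvR_one_sub_sqrt_nonneg (hlt x hx'').le)
        linarith)
    simp only [hΓ0, hs.map_zero, sub_zero, Real.sqrt_one, sub_self] at this
    linarith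
  have := le_of_forall_hasDerivAt_nonneg
    (f := fun t => 1 - √(1 - s t) - (Γ t + curvR (Γ b) * H t)) hb.1
    ((hyc.sub (hΓc.add (hHc.const_mul _))).mono (Icc_subset_Icc_right hb.2)) (by
      intro x hx
      have hx' : x ∈ Ioo 0 T := ⟨hx.1, hx.2.trans_le hb.2⟩
      have hx'' := Ioo_subset_Icc_self hx'
      have hxb := Ioo_subset_Icc_self hx
      refine ⟨_, ?_, ((hs.hasDerivWithinAt_one_sub_sqrt hx'' (hlt x hx'')).sub
        ((hΓ x hx'').add ((hH x hx'').const_mul _))).hasDerivAt (Icc_mem_nhds hx'.1 hx'.2)⟩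
      have := mul_le_mul_of_nonneg_left
        (curvR_le_curvR ((hyΓ x hxb).trans (hmono x hxb)) hm) (neg_nonneg.2 (hκ x hx'').le)
      linarith)
  simp only [hΓ0, hH0, hs.map_zero, sub_zero, Real.sqrt_one, sub_self, mul_zero, add_zero] at this
  linarith

end IsSquareSolution

/-! ### Primitives of the reaction and convection terms. -/

theorem IsConvectiveTerm.hasDerivWithinAt {h : ℝ → ℝ} (hh : IsConvectiveTerm h) {t : ℝ}
    (ht : t ∈ Icc (0 : ℝ) 1) :
    HasDerivWithinAt h (derivWithin h (Icc 0 1) t) (Icc 0 1) t :=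
  (hh.contDiffOn.differentiableOn one_ne_zero t ht).hasDerivWithinAt

theorem IsConvectiveTerm.continuousOn_derivWithin {h : ℝ → ℝ} (hh : IsConvectiveTerm h) :
    ContinuousOn (derivWithin h (Icc 0 1)) (Icc 0 1) :=
  hh.contDiffOn.continuousOn_derivWithin (uniqueDiffOn_Icc one_pos) le_rfl

theorem IsConvectiveTerm.monotoneOn {h : ℝ → ℝ} (hh : IsConvectiveTerm h) :
    MonotoneOn h (Icc 0 1) := fun _ ha _ hb hab =>
  le_of_forall_hasDerivAt_nonneg hab (hh.contDiffOn.continuousOn.mono (Icc_subset_Icc ha.1 hb.2))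
    fun x hx =>
      have hx' : x ∈ Ioo (0 : ℝ) 1 := ⟨ha.1.trans_lt hx.1, hx.2.trans_le hb.2⟩
      ⟨_, (hh.deriv_pos x hx').le, (hh.hasDerivWithinAt (Ioo_subset_Icc_self hx')).hasDerivAt
        (Icc_mem_nhds hx'.1 hx'.2)⟩

theorem IsConvectiveTerm.derivWithin_nonneg {h : ℝ → ℝ} (hh : IsConvectiveTerm h) (t : ℝ) :
    0 ≤ derivWithin h (Icc 0 1) t :=
  hh.monotoneOn.derivWithin_nonneg

namespace IsTypeC

variable {f h : ℝ → ℝ} {u₀ c : ℝ}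

theorem nonpos (hf : IsTypeC f u₀) {t : ℝ} (ht : t ∈ Icc 0 u₀) : f t ≤ 0 := by
  rcases ht.1.eq_or_lt with rfl | h1
  · exact hf.map_zero.le
  rcases ht.2.eq_or_lt with rfl | h2
  · exact hf.map_u₀.le
  exact (hf.neg t ⟨h1, h2⟩).le

theorem nonneg (hf : IsTypeC f u₀) {t : ℝ} (ht : t ∈ Icc u₀ 1) : 0 ≤ f t := by
  rcases ht.1.eq_or_lt with rfl | h1
  · exact hf.map_u₀.ge
  rcases ht.2.eq_or_lt with rfl | h2
  · exact hf.map_one.ge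
  exact (hf.pos t ⟨h1, h2⟩).le

theorem posMass_eq (hf : IsTypeC f u₀) : posMass f = ∫ u in u₀..1, f u := by
  have hu := hf.mem_Ioo
  have hc : ContinuousOn (fun u => max (f u) 0) (Icc 0 1) := hf.contDiffOn.continuousOn.sup
    continuousOn_const
  rw [posMass, ← intervalIntegral.integral_add_adjacent_intervals (b := u₀)
    ((hc.mono (Icc_subset_Icc_right hu.2.le)).intervalIntegrable_of_Icc hu.1.le)
    ((hc.mono (Icc_subset_Icc_left hu.1.le)).intervalIntegrable_of_Icc hu.2.le),
    intervalIntegral.integral_congr (g := fun _ => (0 : ℝ)),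
    intervalIntegral.integral_congr (a := u₀) (g := f)]
  · simp
  · intro x hx
    rw [uIcc_of_le hu.2.le] at hx
    exact max_eq_left (hf.nonneg hx)
  · intro x hx
    rw [uIcc_of_le hu.1.le] at hx
    exact max_eq_right (hf.nonpos hx)

theorem negMass_eq (hf : IsTypeC f u₀) : negMass f = ∫ u in (0 : ℝ)..u₀, -f u := by
  have hu := hf.mem_Ioo
  have hc : ContinuousOn (fun u => max (-f u) 0) (Icc 0 1) := hf.contDiffOn.continuousOn.neg.sup
    continuousOn_const
  rw [negMass, ← intervalIntegral.integral_add_adjacent_intervals (b := u₀)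
    ((hc.mono (Icc_subset_Icc_right hu.2.le)).intervalIntegrable_of_Icc hu.1.le)
    ((hc.mono (Icc_subset_Icc_left hu.1.le)).intervalIntegrable_of_Icc hu.2.le),
    intervalIntegral.integral_congr (g := fun u => -f u),
    intervalIntegral.integral_congr (a := u₀) (g := fun _ => (0 : ℝ))]
  · simp
  · intro x hx
    rw [uIcc_of_le hu.2.le] at hx
    exact max_eq_right (neg_nonpos.2 (hf.nonneg hx))
  · intro x hx
    rw [uIcc_of_le hu.1.le] at hx
    exact max_eq_left (neg_nonneg.2 (hf.nonpos hx))

/-- A global continuous extension makes the primitives of `f` differentiable at the end points as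
well. -/
theorem exists_continuous_eqOn (hf : IsTypeC f u₀) :
    ∃ F : ℝ → ℝ, Continuous F ∧ EqOn F f (Icc 0 1) :=
  ⟨_, hf.contDiffOn.continuousOn.domRestrict.Icc_extend' (h := zero_le_one), fun _ ht =>
    IccExtend_of_mem _ _ ht⟩

theorem exists_primitive_left (hf : IsTypeC f u₀) :
    ∃ Γ : ℝ → ℝ, Γ 0 = 0 ∧ Γ u₀ = negMass f ∧
      ∀ t ∈ Icc 0 u₀, HasDerivWithinAt Γ (-f t) (Icc 0 u₀) t := by
  have hu := hf.mem_Ioo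
  obtain ⟨F, hF, hFf⟩ := hf.exists_continuous_eqOn
  refine ⟨fun t => ∫ u in (0 : ℝ)..t, -F u, by simp, ?_, fun t ht => ?_⟩
  · rw [hf.negMass_eq]
    refine intervalIntegral.integral_congr fun x hx => ?_
    rw [uIcc_of_le hu.1.le] at hx
    simp only [hFf ⟨hx.1, hx.2.trans hu.2.le⟩]
  · rw [← hFf ⟨ht.1, ht.2.trans hu.2.le⟩]
    exact (hF.neg.integral_hasStrictDerivAt 0 t).hasDerivAt.hasDerivWithinAt

theorem exists_primitive_right (hf : IsTypeC f u₀) :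
    ∃ Γ : ℝ → ℝ, Γ 0 = 0 ∧ (∀ t ∈ Icc 0 (1 - u₀), Γ t = ∫ u in (1 - t)..1, f u) ∧
      ∀ t ∈ Icc 0 (1 - u₀), HasDerivWithinAt Γ (f (1 - t)) (Icc 0 (1 - u₀)) t := by
  have hu := hf.mem_Ioo
  obtain ⟨F, hF, hFf⟩ := hf.exists_continuous_eqOn
  refine ⟨fun t => ∫ u in (0 : ℝ)..t, F (1 - u), by simp, fun t ht => ?_, fun t ht => ?_⟩
  · simp only [intervalIntegral.integral_comp_sub_left, sub_zero]
    refine intervalIntegral.integral_congr fun x hx => ?_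
    rw [uIcc_of_le (by linarith [ht.1])] at hx
    exact hFf ⟨by linarith [hx.1, ht.2, hu.1], hx.2⟩
  · rw [← hFf ⟨by linarith [ht.2, hu.1], by linarith [ht.1]⟩]
    exact ((hF.comp (continuous_const.sub continuous_id)).integral_hasStrictDerivAt
      0 t).hasDerivAt.hasDerivWithinAt

/-! ### The two branches, their matching, and shooting in the speed. -/

/-- The forward trajectory from `w = 0` on `[0, u₀]`. -/
def IsLeftBranch (f h : ℝ → ℝ) (u₀ c : ℝ) (s : ℝ → ℝ) : Prop :=
  IsSquareSolution (fun t => c + derivWithin h (Icc 0 1) t) (fun t => -f t) u₀ s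

/-- The backward trajectory from `w = 1` on `[u₀, 1]`, in the variable `t = 1 - w`. -/
def IsRightBranch (f h : ℝ → ℝ) (u₀ c : ℝ) (s : ℝ → ℝ) : Prop :=
  IsSquareSolution (fun t => -(c + derivWithin h (Icc 0 1) (1 - t))) (fun t => f (1 - t)) (1 - u₀) s

theorem exists_isLeftBranch (hf : IsTypeC f u₀) (hh : IsConvectiveTerm h) (c : ℝ) :
    ∃ s, IsLeftBranch f h u₀ c s := by
  have hu := hf.mem_Ioo
  have hsub : Icc 0 u₀ ⊆ Icc 0 1 := Icc_subset_Icc_right hu.2.le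
  exact exists_isSquareSolution hu.1.le
    (continuousOn_const.add (hh.continuousOn_derivWithin.mono hsub))
    (hf.contDiffOn.continuousOn.mono hsub).neg

theorem mapsTo_one_sub (hf : IsTypeC f u₀) :
    MapsTo (fun t : ℝ => 1 - t) (Icc 0 (1 - u₀)) (Icc 0 1) := fun t ht =>
  ⟨by linarith [ht.2, hf.mem_Ioo.1], by linarith [ht.1]⟩

theorem exists_isRightBranch (hf : IsTypeC f u₀) (hh : IsConvectiveTerm h) (c : ℝ) :
    ∃ s, IsRightBranch f h u₀ c s := by
  have hu := hf.mem_Ioo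
  have hc : ContinuousOn (fun t : ℝ => 1 - t) (Icc 0 (1 - u₀)) := by fun_prop
  exact exists_isSquareSolution (by linarith [hu.2])
    (continuousOn_const.add (hh.continuousOn_derivWithin.comp hc hf.mapsTo_one_sub)).neg
    (hf.contDiffOn.continuousOn.comp hc hf.mapsTo_one_sub)

theorem hasDerivWithinAt_left (hf : IsTypeC f u₀) (hh : IsConvectiveTerm h) (c : ℝ) :
    ∀ t ∈ Icc 0 u₀, HasDerivWithinAt (fun t => h t - h 0 + c * t)
      (c + derivWithin h (Icc 0 1) t) (Icc 0 u₀) t := by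
  intro t ht
  have hu := hf.mem_Ioo
  have hsub : Icc 0 u₀ ⊆ Icc 0 1 := Icc_subset_Icc_right hu.2.le
  refine ((((hh.hasDerivWithinAt (hsub ht)).mono hsub).sub_const (h 0)).add
    ((hasDerivWithinAt_id t _).const_mul c)).congr_deriv ?_
  ring

theorem hasDerivWithinAt_right (hf : IsTypeC f u₀) (hh : IsConvectiveTerm h) (c : ℝ) :
    ∀ t ∈ Icc 0 (1 - u₀), HasDerivWithinAt (fun t => h (1 - t) - h 1 - c * t)
      (-(c + derivWithin h (Icc 0 1) (1 - t))) (Icc 0 (1 - u₀)) t := by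
  intro t ht
  refine (((HasDerivWithinAt.comp t (hh.hasDerivWithinAt (hf.mapsTo_one_sub ht))
    ((hasDerivWithinAt_id t _).const_sub 1) hf.mapsTo_one_sub).sub_const (h 1)).sub
    ((hasDerivWithinAt_id t _).const_mul c)).congr_deriv ?_
  ring

theorem neg_pos_left (hf : IsTypeC f u₀) : ∀ t ∈ Ioo 0 u₀, 0 < -f t := fun t ht =>
  neg_pos.2 (hf.neg t ht)

theorem pos_right (hf : IsTypeC f u₀) : ∀ t ∈ Ioo 0 (1 - u₀), 0 < f (1 - t) := fun t ht =>
  hf.pos _ ⟨by linarith [ht.2], by linarith [ht.1]⟩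

theorem rate_neg (hh : IsConvectiveTerm h) (hc : 0 < c) (t : ℝ) :
    -(c + derivWithin h (Icc 0 1) (1 - t)) < 0 := by
  linarith [hh.derivWithin_nonneg (1 - t)]

/-- The right branch stays below `1` because its rate is negative. The left one has `√sl`
increasing, so it lies below its value at `u₀`, which is also the right one's and hence less than
`1`. -/
theorem isAdmissibleSpeed_of_match (hf : IsTypeC f u₀) (hh : IsConvectiveTerm h) (hc : 0 < c)
    {sl sr : ℝ → ℝ} (hl : IsLeftBranch f h u₀ c sl) (hr : IsRightBranch f h u₀ c sr)
    (heq : √(sl u₀) = √(sr (1 - u₀))) : IsAdmissibleSpeed h f c := by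
  have hu := hf.mem_Ioo
  have hmono : ∀ t ∈ Icc 0 u₀, √(sl t) + c * (u₀ - t) ≤ √(sl u₀) := by
    intro t ht
    have h1 := hl.sub_le_sqrt_sub_sqrt hf.neg_pos_left (hf.hasDerivWithinAt_left hh c) ht.1 ht.2
      le_rfl
    have h2 := hh.monotoneOn ⟨ht.1, ht.2.trans hu.2.le⟩ ⟨hu.1.le, hu.2.le⟩ ht.2
    linarith
  have hrlt : ∀ t ∈ Icc 0 (1 - u₀), sr t < 1 := fun t ht =>
    hr.lt_one (fun t _ => rate_neg hh hc t) ht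
  have hpos : 0 < √(sl u₀) := by
    have h1 := hmono 0 ⟨le_rfl, hu.1.le⟩
    rw [hl.map_zero, Real.sqrt_zero] at h1
    have : 0 < c * (u₀ - 0) := mul_pos hc (by linarith [hu.1])
    linarith
  have hlpos : 0 < sl u₀ := Real.sqrt_pos.1 hpos
  have hrpos : 0 < sr (1 - u₀) := Real.sqrt_pos.1 (heq ▸ hpos)
  have hval : sl u₀ = sr (1 - u₀) := (Real.sqrt_inj hlpos.le hrpos.le).1 heq
  have hl1 : sl u₀ < 1 := hval ▸ hrlt _ ⟨by linarith [hu.2], le_rfl⟩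
  have hllt : ∀ t ∈ Icc 0 u₀, sl t < 1 := by
    intro t ht
    have : 0 ≤ c * (u₀ - t) := mul_nonneg hc.le (by linarith [ht.2])
    exact (Real.sqrt_le_sqrt_iff hlpos.le).1 (by linarith [hmono t ht]) |>.trans_lt hl1
  set s : ℝ → ℝ := fun w => if w ≤ u₀ then sl w else sr (1 - w) with hs
  have esl : ∀ w ≤ u₀, s w = sl w := fun w hw => if_pos hw
  have esr : ∀ w, u₀ ≤ w → s w = sr (1 - w) := by
    intro w hw
    rcases hw.eq_or_lt with rfl | h
    · rw [esl _ le_rfl, hval]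
    · exact if_neg (not_le.2 h)
  have hmemr : ∀ w ∈ Icc u₀ 1, 1 - w ∈ Icc 0 (1 - u₀) := fun w hw =>
    ⟨by linarith [hw.2], by linarith [hw.1]⟩
  have hslt : ∀ w ∈ Icc (0 : ℝ) 1, s w < 1 := by
    intro w hw
    rcases le_total w u₀ with h | h
    · rw [esl w h]; exact hllt w ⟨hw.1, h⟩
    · rw [esr w h]; exact hrlt _ (hmemr w ⟨h, hw.2⟩)
  have hspos : ∀ w ∈ Ioo (0 : ℝ) 1, 0 < s w := by
    intro w hw
    rcases lt_trichotomy w u₀ with h | rfl | h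
    · rw [esl w h.le]; exact hl.pos hf.neg_pos_left ⟨hw.1, h⟩
    · rw [esl w le_rfl]; exact hlpos
    · rw [esr w h.le]; exact hr.pos hf.pos_right ⟨by linarith [hw.2], by linarith⟩
  refine ⟨fun w => 1 - √(1 - s w), ?_, ?_, ?_, ?_, ?_⟩
  · intro w hw
    rw [← Icc_union_Icc_eq_Icc hu.1.le hu.2.le]
    -- At `u₀` both sides contribute the same derivative; elsewhere one of the two intervals stays
    -- away from `w` and its condition is vacuous.
    refine HasDerivWithinAt.union ?_ ?_
    · rcases le_or_gt w u₀ with h | h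
      · have hd := hl.hasDerivWithinAt_one_sub_sqrt ⟨hw.1, h⟩ (hllt w ⟨hw.1, h⟩)
        rw [← esl w h] at hd
        rw [Icc_union_Icc_eq_Icc hu.1.le hu.2.le]
        exact hd.congr (fun x hx => by simp only [esl x hx.2])
          (by simp only [esl w h])
      · exact HasFDerivWithinAt.of_notMem_closure (by
          rw [closure_Icc]; exact fun h' => absurd h'.2 (not_le.2 h))
    · rcases le_or_gt u₀ w with h | h
      · have hw' := hmemr w ⟨h, hw.2⟩
        have hd := HasDerivWithinAt.comp w (hr.hasDerivWithinAt_one_sub_sqrt hw' (hrlt _ hw'))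
          ((hasDerivWithinAt_id w (Icc u₀ 1)).const_sub 1) hmemr
        rw [← esr w h, sub_sub_cancel] at hd
        rw [Icc_union_Icc_eq_Icc hu.1.le hu.2.le]
        refine (hd.congr (fun x hx => ?_) ?_).congr_deriv ?_
        · simp only [esr x hx.1, Function.comp_apply]
        · simp only [esr w h, Function.comp_apply]
        · ring
      · exact HasFDerivWithinAt.of_notMem_closure (by
          rw [closure_Icc]; exact fun h' => absurd h'.1 (not_le.2 h))
  · simp only [esl 0 hu.1.le, hl.map_zero]; simp
  · simp only [esr 1 hu.2.le, sub_self, hr.map_zero]; simp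
  · intro w hw
    have h1 := hspos w hw
    have : √(1 - s w) < 1 := (Real.sqrt_lt' one_pos).2 (by linarith)
    linarith
  · intro w hw
    have := Real.sqrt_pos.2 (sub_pos.2 (hslt w (Ioo_subset_Icc_self hw)))
    linarith

theorem exists_pos_isAdmissibleSpeed (hf : IsTypeC f u₀) (hh : IsConvectiveTerm h) (hc : 0 < c)
    (hord : ∀ sl sr, IsLeftBranch f h u₀ c sl → IsRightBranch f h u₀ c sr →
      √(sl u₀) ≤ √(sr (1 - u₀))) :
    ∃ c' : ℝ, 0 < c' ∧ IsAdmissibleSpeed h f c' := by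
  have hu := hf.mem_Ioo
  choose SL hSL using hf.exists_isLeftBranch hh
  choose SR hSR using hf.exists_isRightBranch hh
  -- The Lipschitz bound holds for any choice of Peano solutions, so the arbitrary selections `SL`
  -- and `SR` still depend continuously on `c` at `u₀`.
  have hA : Continuous fun c => √(SL c u₀) :=
    (LipschitzWith.of_le_add_mul (⟨u₀, hu.1.le⟩ : NNReal) fun x y => by
      have := IsSquareSolution.sqrt_le_sqrt_add_mul (dist_nonneg (x := x) (y := y))
        hf.neg_pos_left (hSL x) (hSL y)
        (fun t _ => by linarith [Real.dist_eq x y ▸ le_abs_self (x - y)]) ⟨hu.1.le, le_rfl⟩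
      rwa [mul_comm] at this).continuous
  have hB : Continuous fun c => √(SR c (1 - u₀)) :=
    (LipschitzWith.of_le_add_mul (⟨1 - u₀, by linarith [hu.2]⟩ : NNReal) fun x y => by
      have := IsSquareSolution.sqrt_le_sqrt_add_mul (dist_nonneg (x := x) (y := y))
        hf.pos_right (hSR x) (hSR y)
        (fun t _ => by linarith [Real.dist_eq x y ▸ neg_abs_le (x - y)])
        ⟨by linarith [hu.2], le_rfl⟩
      rwa [mul_comm] at this).continuous
  -- Since `√s` grows at rate at least `c₁` on the left, `c₁ u₀ ≥ 1` pushes the left value to `1` or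
  -- beyond.
  set c₁ := max c (1 / u₀)
  have hc₁ : 1 ≤ c₁ * u₀ := by
    rw [← div_le_iff₀ hu.1]; exact le_max_right _ _
  have hAc : 1 ≤ √(SL c₁ u₀) := by
    have h1 := (hSL c₁).sub_le_sqrt_sub_sqrt hf.neg_pos_left (hf.hasDerivWithinAt_left hh c₁)
      le_rfl hu.1.le le_rfl
    have h2 := hh.monotoneOn ⟨le_rfl, zero_le_one⟩ ⟨hu.1.le, hu.2.le⟩ hu.1.le
    rw [(hSL c₁).map_zero, Real.sqrt_zero] at h1
    linarith
  have hBc : √(SR c₁ (1 - u₀)) ≤ 1 := by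
    have h1 := (hSR c₁).lt_one (fun t _ => rate_neg hh (hc.trans_le (le_max_left _ _)) t)
      ⟨by linarith [hu.2], le_rfl⟩
    exact Real.sqrt_le_one.2 h1.le
  obtain ⟨c', hc', h0⟩ := intermediate_value_Icc (le_max_left c (1 / u₀))
    (hA.sub hB).continuousOn (show (0 : ℝ) ∈ _ from
      ⟨sub_nonpos.2 (hord _ _ (hSL c) (hSR c)), sub_nonneg.2 (hBc.trans hAc)⟩)
  have hc'0 := hc.trans_le hc'.1
  exact ⟨c', hc'0, hf.isAdmissibleSpeed_of_match hh hc'0 (hSL c') (hSR c') (sub_eq_zero.1 h0)⟩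

theorem left_lt (hf : IsTypeC f u₀) (hh : IsConvectiveTerm h) (hc : 0 < c) {m : ℝ} (hm : m < 1)
    (hB : negMass f + curvR m * (h u₀ - h 0 + c * u₀) < m) {s : ℝ → ℝ}
    (hs : IsLeftBranch f h u₀ c s) : s u₀ < m * (2 - m) := by
  obtain ⟨Γ, hΓ0, hΓ, hΓd⟩ := hf.exists_primitive_left
  exact hs.lt_of_barrier_lt (fun t _ => by linarith [hh.derivWithin_nonneg t])
    (fun t ht => neg_nonneg.2 (hf.nonpos ht)) (hf.hasDerivWithinAt_left hh c) hΓd (by simp) hΓ0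
    hf.mem_Ioo.1.le hm (by rwa [hΓ])

theorem right_gt (hf : IsTypeC f u₀) (hh : IsConvectiveTerm h) (hc : 0 < c) {ξ m p : ℝ}
    (hξ : ξ ∈ Ico u₀ 1) (hm : ∫ u in ξ..1, f u = m) (hm1 : m < 1)
    (hB : p < m - curvR m * (h 1 - h ξ + c * (1 - ξ))) {s : ℝ → ℝ}
    (hs : IsRightBranch f h u₀ c s) : p * (2 - p) < s (1 - ξ) := by
  obtain ⟨Γ, hΓ0, hΓ, hΓd⟩ := hf.exists_primitive_right
  have hmem : 1 - ξ ∈ Icc 0 (1 - u₀) := ⟨by linarith [hξ.2], by linarith [hξ.1]⟩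
  have hΓξ : Γ (1 - ξ) = m := by rw [hΓ _ hmem, sub_sub_cancel, hm]
  have h1 := hs.barrier_le (fun t _ => rate_neg hh hc t)
    (fun t ht => hf.nonneg ⟨by linarith [ht.2], by linarith [ht.1]⟩)
    (hf.hasDerivWithinAt_right hh c) hΓd (by simp) hΓ0 hmem (by rwa [hΓξ])
  rw [hΓξ, sub_sub_cancel] at h1
  have h2 : √(1 - s (1 - ξ)) < 1 - p := by linarith
  have h3 := (Real.sqrt_lt' ((Real.sqrt_nonneg _).trans_lt h2)).1 h2
  linarith

/-- Discarding the nonnegative source, `√s` decreases at most at rate `c + h'` going back from `ξ`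
to `u₀`; no bound on the mass of `f` is needed. -/
theorem right_sqrt_ge (hf : IsTypeC f u₀) (hh : IsConvectiveTerm h) {ξ : ℝ}
    (hξ : ξ ∈ Icc u₀ 1) {s : ℝ → ℝ} (hs : IsRightBranch f h u₀ c s) :
    √(s (1 - ξ)) - (h ξ - h u₀ + c * (ξ - u₀)) ≤ √(s (1 - u₀)) := by
  have h1 := hs.sub_le_sqrt_sub_sqrt hf.pos_right (hf.hasDerivWithinAt_right hh c)
    (a := 1 - ξ) (b := 1 - u₀) (by linarith [hξ.2]) (by linarith [hξ.1]) le_rfl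
  simp only [sub_sub_cancel] at h1
  linarith

end IsTypeC

/-! ### Small positive speeds and the conclusion. -/

theorem curvR_pos {m : ℝ} (h0 : 0 < m) (h1 : m < 1) : 0 < curvR m :=
  div_pos (Real.sqrt_pos.2 (mul_pos h0 (by linarith))) (by linarith)

theorem eventually_mul_add_mul_lt {X Y Z W : ℝ} (h : X * Y < W) :
    ∀ᶠ c in 𝓝[>] (0 : ℝ), X * (Y + c * Z) < W := by
  have hc : Continuous fun c : ℝ => X * (Y + c * Z) := by fun_prop
  have := (hc.tendsto 0).eventually_lt_const (u := W) (by simpa using h)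
  exact nhdsWithin_le_nhds this

theorem mainTheorem5 (f h : ℝ → ℝ) (u₀ η : ℝ)
    (hf : IsTypeC f u₀) (hh : IsConvectiveTerm h)
    (hh₀ : h u₀ < 1 + h 0)
    (hfint : 0 < ∫ u in (0 : ℝ)..1, f u) (hfneg : negMass f < 1)
    (hη : 0 < η) (hη' : η < min (posMass f) 1 - negMass f)
    (hC1 : h u₀ - h 0 <
      (1 - negMass f - η) / √((negMass f + η) * (2 - negMass f - η)) * η) :
    (posMass f < 1 →
      h 1 - h u₀ <
        (1 - posMass f) / √(posMass f * (2 - posMass f)) * (posMass f - negMass f - η) →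
      ∃ c : ℝ, 0 < c ∧ IsAdmissibleSpeed h f c) ∧
    (1 ≤ posMass f →
      ∀ ζ ξ₀ : ℝ, 0 < ζ → ζ < 1 - negMass f - η → ξ₀ ∈ Set.Ioo u₀ 1 →
        (∫ u in ξ₀..1, f u) = 1 - ζ →
        h ξ₀ - h u₀ <
          √(1 - ((1 + ζ - negMass f - η) / 2) ^ 2) - √(1 - (1 - negMass f - η) ^ 2) →
        h 1 - h ξ₀ < (1 - ζ - negMass f - η) / 2 * (ζ / √(1 - ζ ^ 2)) →
      ∃ c : ℝ, 0 < c ∧ IsAdmissibleSpeed h f c) := by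
  have hu := hf.mem_Ioo
  have hN : 0 ≤ negMass f := intervalIntegral.integral_nonneg zero_le_one fun u _ => le_max_right _ _
  set m := negMass f + η with hm
  have hm0 : 0 < m := by linarith
  have hm1 : m < 1 := by linarith [min_le_right (posMass f) 1]
  have hmP : m < posMass f := by linarith [min_le_left (posMass f) 1]
  have hleft : ∀ᶠ c in 𝓝[>] (0 : ℝ), curvR m * (h u₀ - h 0 + c * u₀) < η := by
    refine eventually_mul_add_mul_lt ?_
    -- The coefficient in the hypothesis is `1 / R(m)`, so `hC1` says `R(m)(h u₀ - h 0) < η`, the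
    -- left barrier condition at `c = 0`.
    have e : (1 - negMass f - η) / √(m * (2 - negMass f - η)) = (curvR m)⁻¹ := by
      rw [curvR, inv_div, show 2 - negMass f - η = 2 - m by rw [hm]; ring,
        show 1 - negMass f - η = 1 - m by rw [hm]; ring]
    rwa [e, inv_mul_eq_div, lt_div_iff₀' (curvR_pos hm0 hm1)] at hC1
  constructor
  · intro hP1 hC
    have hP0 : 0 < posMass f := hm0.trans hmP
    have hright : ∀ᶠ c in 𝓝[>] (0 : ℝ),
        curvR (posMass f) * (h 1 - h u₀ + c * (1 - u₀)) < posMass f - m := by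
      refine eventually_mul_add_mul_lt ?_
      rwa [← inv_div, ← curvR, inv_mul_eq_div, lt_div_iff₀' (curvR_pos hP0 hP1), sub_sub] at hC
    obtain ⟨c, hcl, hcr, hc⟩ := (hleft.and (hright.and self_mem_nhdsWithin)).exists
    refine hf.exists_pos_isAdmissibleSpeed hh hc fun sl sr hl hr => Real.sqrt_le_sqrt ?_
    exact (hf.left_lt hh hc hm1 (by linarith) hl).le.trans
      (hf.right_gt hh hc ⟨le_rfl, hu.2⟩ hf.posMass_eq.symm hP1 (p := m) (by linarith) hr).le
  · intro _ ζ ξ₀ hζ0 hζ hξ hint hC2 hC3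
    have hζm : ζ < 1 - m := by linarith
    -- `p` is the midpoint of `m` and `1 - ζ`: on `[ξ₀, 1]` the convection may cost half the gap,
    -- and the drop of `√s` on `[u₀, ξ₀]` may use the rest.
    set p := (1 - ζ + m) / 2 with hp
    have hright : ∀ᶠ c in 𝓝[>] (0 : ℝ),
        curvR (1 - ζ) * (h 1 - h ξ₀ + c * (1 - ξ₀)) < (1 - ζ - m) / 2 := by
      refine eventually_mul_add_mul_lt ?_
      have e : ζ / √(1 - ζ ^ 2) = (curvR (1 - ζ))⁻¹ := by
        rw [curvR, inv_div]
        congr 2 <;> ring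
      rwa [e, ← div_eq_mul_inv, lt_div_iff₀' (curvR_pos (by linarith) (by linarith)),
        sub_sub (1 - ζ)] at hC3
    have hmid : ∀ᶠ c in 𝓝[>] (0 : ℝ),
        1 * (h ξ₀ - h u₀ + c * (ξ₀ - u₀)) < √(p * (2 - p)) - √(m * (2 - m)) := by
      refine eventually_mul_add_mul_lt ?_
      have e1 : 1 - ((1 + ζ - negMass f - η) / 2) ^ 2 = p * (2 - p) := by rw [hp, hm]; ring
      have e2 : 1 - (1 - negMass f - η) ^ 2 = m * (2 - m) := by rw [hm]; ring
      rwa [one_mul, ← e1, ← e2]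
    obtain ⟨c, hcl, hcr, hcm, hc⟩ :=
      (hleft.and (hright.and (hmid.and self_mem_nhdsWithin))).exists
    refine hf.exists_pos_isAdmissibleSpeed hh hc fun sl sr hl hr => ?_
    have h1 := Real.sqrt_le_sqrt (hf.left_lt hh hc hm1 (by linarith) hl).le
    have h2 := Real.sqrt_le_sqrt (hf.right_gt hh hc ⟨hξ.1.le, hξ.2⟩ hint (by linarith) (p := p)
      (by rw [hp]; linarith) hr).le
    have h3 := hf.right_sqrt_ge hh (Ioo_subset_Icc_self hξ) hr
    linarith
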